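/- Let $n\ge 2$, let $\mathcal A=\{A_1,\dots,A_n\}$ be a set of quantum systems with finite-dimensional complex Hilbert spaces $\mathcal H_{A_i}$, let $\rho$ be a density operator (positive semidefinite, $\operatorname{Tr}\rho=1$) on $\mathcal H_{A_1}\otimes\cdots\otimes\mathcal H_{A_n}$, and let $q>1$. For $J\subseteq\mathcal A$ let $\rho_J$ be the marginal of $\rho$ on $J$ (the partial trace over the systems outside $J$), and put $$S_q(J)_\rho=\frac{1}{1-q}\bigl(\operatorname{Tr}\rho_J^{\,q}-1\bigr),\qquad C_q(J)_\rho=\sum_{v\in J}S_q(\{v\})_\rho-S_q(J)_\rho ,$$ so that $S_q(\varnothing)_\rho=0$. Let $K$ be a field. Then $C_q(I)_\rho\le C_q(J)_\rho$ for all $\varnothing\ne I\subseteq J\subseteq\mathcal A$, so that the sets $$G(\varepsilon)=\{J\subseteq\mathcal A : J\neq\varnothing,\ C_q(J)_\rho\le\varepsilon\},\qquad \varepsilon\in\mathbb R,$$ form a filtration by abstract simplicial complexes. Let $\widetilde\beta_k(\varepsilon)=\dim_K\widetilde H_k(G(\varepsilon);K)$, $k\ge 0$, be the reduced Betti numbers,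 that is, the dimensions of the homology groups of the augmented simplicial chain complex, and let $$\widetilde{\mathfrak X}_q(\varepsilon)=\sum_{k=0}^{\infty}(-1)^k\int_0^{\varepsilon}\widetilde\beta_k(t)\,dt$$ be the reduced integrated Euler characteristic. Each $\widetilde\beta_k$ is integrable on $(0,\infty)$, the series converges for every $\varepsilon$, and $\widetilde{\mathfrak X}_q(\infty):=\lim_{\varepsilon\to\infty}\widetilde{\mathfrak X}_q(\varepsilon)$ exists and equals the $q$-deformed interaction information: $$\widetilde{\mathfrak X}_q(\infty)=\sum_{J\subseteq\mathcal A}(-1)^{|J|-1}S_q(J)_\rho=I_q(\mathcal A)_\rho .$$ -/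

import Mathlib

open scoped ComplexOrder

noncomputable section

/-! ### Quantum states, marginals and entropies

A system of parties is a finite index type `ι`; party `i` has Hilbert space `ℂ^(d i)` for a finite
index type `d i`, so that the joint Hilbert space is `ℂ^(Π i, d i)`, and operators are written as
matrices in the product basis. -/

/-- Density operators: positive semidefinite with unit trace. -/
structure IsDensityOperator {a : Type*} [Fintype a] (ρ : Matrix a a ℂ) : Prop where
  posSemidef : ρ.PosSemidef
  trace_eq_one : ρ.trace = 1

/-- The marginal `ρ_J`: the partial trace of `ρ` over all parties outside `J`. -/
def marginal {ι : Type*} [Fintype ι] [DecidableEq ι] {d : ι → Type*} [∀ i, Fintype (d i)]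
    (ρ : Matrix (∀ i, d i) (∀ i, d i) ℂ) (J : Finset ι) :
    Matrix (∀ i : {i // i ∈ J}, d i) (∀ i : {i // i ∈ J}, d i) ℂ :=
  fun x y => ∑ z : (∀ i : {i // i ∉ J}, d i),
    ρ ((Equiv.piEquivPiSubtypeProd (fun i => i ∈ J) d).symm (x, z))
      ((Equiv.piEquivPiSubtypeProd (fun i => i ∈ J) d).symm (y, z))

/-- The Tsallis entropy `S_q(σ) = (Tr σ^q - 1) / (1 - q)`; the power `σ^q` is taken in the
functional calculus of the Hermitian matrix `σ`. -/
def tsallisEntropy {a : Type*} [Fintype a] [DecidableEq a] (q : ℝ) (σ : Matrix a a ℂ) : ℝ :=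
  1 / (1 - q) * ((cfc (fun x : ℝ => x ^ q) σ).trace.re - 1)

/-- `S_q(J)_ρ`, the Tsallis entropy of the marginal on `J`. For `J = ∅` the marginal is the
`1 × 1` matrix with entry `Tr ρ`, so this is `0` for a density operator. -/
def subsystemEntropy {ι : Type*} [Fintype ι] [DecidableEq ι] {d : ι → Type*} [∀ i, Fintype (d i)]
    [∀ i, DecidableEq (d i)] (q : ℝ) (ρ : Matrix (∀ i, d i) (∀ i, d i) ℂ) (J : Finset ι) : ℝ :=
  tsallisEntropy q (marginal ρ J)

/-- The `q`-deformed total correlation `C_q(J)_ρ`. -/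
def totalCorrelation {ι : Type*} [Fintype ι] [DecidableEq ι] {d : ι → Type*} [∀ i, Fintype (d i)]
    [∀ i, DecidableEq (d i)] (q : ℝ) (ρ : Matrix (∀ i, d i) (∀ i, d i) ℂ) (J : Finset ι) : ℝ :=
  ∑ v ∈ J, subsystemEntropy q ρ {v} - subsystemEntropy q ρ J

/-- The `q`-deformed interaction information `I_q(𝒜)_ρ` of the set `𝒜` of all parties. -/
def interactionInformation {ι : Type*} [Fintype ι] [DecidableEq ι] {d : ι → Type*}
    [∀ i, Fintype (d i)] [∀ i, DecidableEq (d i)] (q : ℝ)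
    (ρ : Matrix (∀ i, d i) (∀ i, d i) ℂ) : ℝ :=
  ∑ J : Finset ι, (-1 : ℝ) ^ ((J.card : ℤ) - 1) * subsystemEntropy q ρ J

/-! ### Reduced simplicial homology over a field -/

/-- The boundary operator on formal `K`-linear combinations `∑ c J • J` of sets of vertices,
`∂ (v₀ < ⋯ < v_k) = ∑ i, (-1)^i (v₀, …, v̂_i, …, v_k)`. A vertex `{v}` is sent to the empty
simplex, which is the augmentation. -/
def simplicialBoundary (K : Type*) [Field K] (ι : Type*) [Fintype ι] [LinearOrder ι] :
    (Finset ι → K) →ₗ[K] (Finset ι → K) :=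
  Fintype.linearCombination K fun J : Finset ι =>
    ∑ v ∈ J, Pi.single (J.erase v) ((-1 : K) ^ (J.filter (· < v)).card)

/-- The augmented chain group spanned by the simplices of `G` with exactly `m` vertices; the
simplicial dimension is `m - 1`. The empty simplex is always present and spans the copy of `K`
in dimension `-1`. -/
def augmentedChains (K : Type*) [Field K] {ι : Type*}
    (G : PreAbstractSimplicialComplex ι) (m : ℕ) : Submodule K (Finset ι → K) where
  carrier := {c | ∀ J : Finset ι, c J ≠ 0 → (J = ∅ ∨ J ∈ G.faces) ∧ J.card = m}
  zero_mem' := fun _ h => absurd rfl h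
  add_mem' := fun {a b} ha hb J h => by
    by_cases h0 : a J = 0
    · exact hb J fun h1 => h (by simp [h0, h1])
    · exact ha J h0
  smul_mem' := fun r a ha J h => ha J fun h0 => h (by simp [h0])

/-- The `k`-cycles of the augmented chain complex of `G`. -/
def reducedCycles (K : Type*) [Field K] {ι : Type*} [Fintype ι] [LinearOrder ι]
    (G : PreAbstractSimplicialComplex ι) (k : ℕ) : Submodule K (Finset ι → K) :=
  augmentedChains K G (k + 1) ⊓ LinearMap.ker (simplicialBoundary K ι)

/-- The `k`-boundaries of `G`: the image of the `(k + 1)`-chains. -/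
def reducedBoundaries (K : Type*) [Field K] {ι : Type*} [Fintype ι] [LinearOrder ι]
    (G : PreAbstractSimplicialComplex ι) (k : ℕ) : Submodule K (Finset ι → K) :=
  (augmentedChains K G (k + 2)).map (simplicialBoundary K ι)

/-- The reduced homology of `G` in dimension `k`, cycles modulo boundaries. -/
abbrev ReducedHomology (K : Type*) [Field K] {ι : Type*} [Fintype ι] [LinearOrder ι]
    (G : PreAbstractSimplicialComplex ι) (k : ℕ) : Type _ :=
  reducedCycles K G k ⧸ (reducedBoundaries K G k).submoduleOf (reducedCycles K G k)

/-! ### The persistence complex of a monotone functional and its summaries -/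

/-- Monotonicity of a functional on the nonempty subsets (its value at `∅` plays no role). -/
def IsMonotoneFunctional {ι : Type*} (F : Finset ι → ℝ) : Prop :=
  ∀ I J : Finset ι, I.Nonempty → I ⊆ J → F I ≤ F J

/-- The sublevel complex `G(ε) = {J ≠ ∅ : F J ≤ ε}` of a monotone functional `F`. -/
def sublevelComplex {ι : Type*} (F : Finset ι → ℝ) (hF : IsMonotoneFunctional F) (ε : ℝ) :
    PreAbstractSimplicialComplex ι where
  faces := {J | J.Nonempty ∧ F J ≤ ε}
  isRelLowerSet_faces := fun J hJ =>
    ⟨hJ.1, fun I hIJ hI => ⟨hI, (hF I J hI hIJ).trans hJ.2⟩⟩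

/-- The reduced Betti number of `G(ε)` in dimension `k`. -/
def reducedBetti (K : Type*) [Field K] {ι : Type*} [Fintype ι] [LinearOrder ι]
    (F : Finset ι → ℝ) (hF : IsMonotoneFunctional F) (k : ℕ) (ε : ℝ) : ℕ :=
  Module.finrank K (ReducedHomology K (sublevelComplex F hF ε) k)

/-- The reduced integrated Betti number, `∫₀^ε` of the reduced Betti number. -/
def reducedIntegratedBetti (K : Type*) [Field K] {ι : Type*} [Fintype ι] [LinearOrder ι]
    (F : Finset ι → ℝ) (hF : IsMonotoneFunctional F) (k : ℕ) (ε : ℝ) : ℝ :=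
  ∫ t in (0 : ℝ)..ε, (reducedBetti K F hF k t : ℝ)

/-- The reduced integrated Euler characteristic up to filtration value `ε`. -/
def reducedIntegratedEulerChar (K : Type*) [Field K] {ι : Type*} [Fintype ι] [LinearOrder ι]
    (F : Finset ι → ℝ) (hF : IsMonotoneFunctional F) (ε : ℝ) : ℝ :=
  ∑' k : ℕ, (-1 : ℝ) ^ k * reducedIntegratedBetti K F hF k ε

end

/-!
**Monotonicity of `C_q`.** This is subadditivity of the Tsallis entropy of a bipartite state. For a
probability vector `p` on a product, testing both marginals against their Hölder dual vectors gives
`‖p₁‖_q + ‖p₂‖_q ≤ 1 + ‖p‖_q`; all norms are at most `1`, so by convexity of `x ↦ x ^ q` the same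
inequality holds for the `q`-th powers. For a state `ρ`, take as `p` the diagonal of `ρ` in the
product of eigenbases of its two marginals: the marginals of `p` are then the spectra of the
marginals of `ρ`, and `∑ p ^ q ≤ Tr ρ ^ q` by Jensen's inequality.

**The integral.** For `t ≥ 0` all vertices belong to `G(t)`, and the Euler–Poincaré formula
expresses the reduced Euler characteristic of `G(t)` as the sum of `(-1) ^ |J|` over the nonempty
`J` with `t < C_q(J)`. Past `C_q(𝒜)` the complex is a full simplex, hence a cone, and its reduced
homology vanishes. Integrating over `t` therefore yields `∑ (-1) ^ |J| C_q(J)`, in which the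
contributions of the single-party entropies cancel as soon as there are two parties.
-/

open scoped NNReal

section PowerSums

theorem add_le_add_of_convexOn {𝕜 : Type*} [Field 𝕜] [LinearOrder 𝕜] [IsStrictOrderedRing 𝕜]
    {s : Set 𝕜} {f : 𝕜 → 𝕜} (hf : ConvexOn 𝕜 s f) {w x y z : 𝕜}
    (hw : w ∈ s) (hz : z ∈ s) (hwx : w ≤ x) (hxz : x ≤ z) (hsum : x + y = w + z) :
    f x + f y ≤ f w + f z := by
  obtain ⟨a, b, ha, hb, hab, rfl⟩ : x ∈ segment 𝕜 w z := by
    rw [segment_eq_Icc (hwx.trans hxz)]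
    exact ⟨hwx, hxz⟩
  obtain rfl : y = b • w + a • z := by
    simp only [smul_eq_mul] at hsum ⊢
    linear_combination hsum - (w + z) * hab
  have hfx := hf.2 hw hz ha hb hab
  have hfy := hf.2 hw hz hb ha (by rwa [add_comm])
  simp only [smul_eq_mul] at hfx hfy ⊢
  linear_combination hfx + hfy + (f w + f z) * hab

theorem rpow_add_rpow_le_one_add_rpow {q : ℝ} (hq : 1 ≤ q) {x y z : ℝ≥0} (hx : x ≤ 1) (hy : y ≤ 1)
    (h : x + y ≤ 1 + z) : x ^ q + y ^ q ≤ 1 + z ^ q := by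
  rcases le_total (x + y) 1 with hxy | hxy
  · calc x ^ q + y ^ q ≤ x + y := by gcongr <;> exact NNReal.rpow_le_self_of_le_one ‹_› hq
      _ ≤ 1 + z ^ q := hxy.trans le_self_add
  · obtain ⟨w, hw⟩ := exists_add_of_le hxy
    have hwx : w ≤ x := le_of_add_le_add_left (hw ▸ add_comm x y ▸ add_le_add_left hy x)
    have hwz : w ≤ z := le_of_add_le_add_left (hw ▸ h)
    have hconv : x ^ q + y ^ q ≤ w ^ q + 1 := by
      have := add_le_add_of_convexOn (convexOn_rpow hq) (w := w) (x := x) (y := y) (z := 1) w.2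
        (Set.mem_Ici.2 zero_le_one) hwx hx (by rw [add_comm (w : ℝ)]; exact_mod_cast hw)
      rw [Real.one_rpow] at this
      exact_mod_cast this
    calc x ^ q + y ^ q ≤ w ^ q + 1 := hconv
      _ ≤ z ^ q + 1 := by gcongr
      _ = 1 + z ^ q := add_comm _ _

theorem sum_rpow_le_rpow_sum {α : Type*} {q : ℝ} (hq : 1 ≤ q) (s : Finset α) (f : α → ℝ≥0) :
    ∑ i ∈ s, f i ^ q ≤ (∑ i ∈ s, f i) ^ q := by
  classical
  induction s using Finset.induction_on with
  | empty => simp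
  | insert a s ha ih =>
    rw [Finset.sum_insert ha, Finset.sum_insert ha]
    exact (add_le_add_right ih _).trans (NNReal.add_rpow_le_rpow_add _ _ hq)

variable {α β : Type*} [Fintype α] [Fintype β]

theorem exists_holder_dual {q r : ℝ} (hqr : q.HolderConjugate r) (f : α → ℝ≥0) :
    ∃ x : α → ℝ≥0, (∀ i, x i ≤ 1) ∧ ∑ i, x i ^ r ≤ 1 ∧
      ∑ i, f i * x i = (∑ i, f i ^ q) ^ (1 / q) := by
  obtain ⟨x, hx, hfx⟩ := (NNReal.isGreatest_Lp Finset.univ f hqr).1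
  refine ⟨x, fun i => ?_, hx, hfx⟩
  rw [← NNReal.rpow_le_rpow_iff hqr.symm.pos, NNReal.one_rpow]
  exact (Finset.single_le_sum_of_canonicallyOrdered (f := fun i => x i ^ r)
    (Finset.mem_univ i)).trans hx

theorem Lp_marginals_add_le {q : ℝ} (hq : 1 < q) (p : α → β → ℝ≥0) :
    (∑ i, (∑ j, p i j) ^ q) ^ (1 / q) + (∑ j, (∑ i, p i j) ^ q) ^ (1 / q) ≤
      ∑ i, ∑ j, p i j + (∑ i, ∑ j, p i j ^ q) ^ (1 / q) := by
  have hqr := Real.HolderConjugate.conjExponent hq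
  obtain ⟨x, hx1, hxr, hx⟩ := exists_holder_dual hqr fun i => ∑ j, p i j
  obtain ⟨y, hy1, hyr, hy⟩ := exists_holder_dual hqr fun j => ∑ i, p i j
  have hxy : ∑ i, ∑ j, (x i * y j) ^ q.conjExponent ≤ 1 := by
    simpa only [NNReal.mul_rpow, ← Finset.sum_mul_sum] using mul_le_one' hxr hyr
  have holder : ∑ i, ∑ j, p i j * (x i * y j) ≤ (∑ i, ∑ j, p i j ^ q) ^ (1 / q) := by
    simpa only [Fintype.sum_prod_type] using (NNReal.isGreatest_Lp Finset.univ
      (fun k : α × β => p k.1 k.2) hqr).2 ⟨fun k => x k.1 * y k.2,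
        by simpa only [Set.mem_ofPred_eq, Fintype.sum_prod_type] using hxy, rfl⟩
  calc _ = ∑ i, ∑ j, p i j * (x i + y j) := by
        simp only [← hx, ← hy, Finset.sum_mul, mul_add, Finset.sum_add_distrib]
        rw [Finset.sum_comm (f := fun j i => p i j * y j)]
    _ ≤ ∑ i, ∑ j, p i j * (1 + x i * y j) := by
        gcongr ∑ i, ∑ j, p i j * ?_ with i _ j _
        simpa only [one_mul, mul_one, add_comm (x i * y j)] using
          mul_add_mul_le_mul_add_mul (hx1 i) (hy1 j)
    _ = ∑ i, ∑ j, p i j + ∑ i, ∑ j, p i j * (x i * y j) := by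
        simp only [mul_add, mul_one, Finset.sum_add_distrib]
    _ ≤ _ := by gcongr

theorem sum_rpow_marginals_le {q : ℝ} (hq : 1 < q) (p : α → β → ℝ≥0)
    (hp : ∑ i, ∑ j, p i j = 1) :
    ∑ i, (∑ j, p i j) ^ q + ∑ j, (∑ i, p i j) ^ q ≤ 1 + ∑ i, ∑ j, p i j ^ q := by
  have hq0 : q ≠ 0 := (zero_lt_one.trans hq).ne'
  have hrow : ∑ i, (∑ j, p i j) ^ q ≤ 1 := by
    simpa only [hp, NNReal.one_rpow] using
      sum_rpow_le_rpow_sum hq.le Finset.univ fun i => ∑ j, p i j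
  have hcol : ∑ j, (∑ i, p i j) ^ q ≤ 1 := by
    simpa only [Finset.sum_comm.trans hp, NNReal.one_rpow] using
      sum_rpow_le_rpow_sum hq.le Finset.univ fun j => ∑ i, p i j
  have hnorm := Lp_marginals_add_le hq p
  rw [hp, one_div] at hnorm
  have hinv : 0 ≤ q⁻¹ := inv_nonneg.2 (zero_le_one.trans hq.le)
  simpa only [NNReal.rpow_inv_rpow hq0] using rpow_add_rpow_le_one_add_rpow hq.le
    (NNReal.rpow_le_one hrow hinv) (NNReal.rpow_le_one hcol hinv) hnorm

end PowerSums

section Peierls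

open Matrix

variable {n 𝕜 : Type*} [Fintype n] [DecidableEq n] [RCLike 𝕜]

theorem sum_map_mulVec_le_of_mem_doublyStochastic {M : Matrix n n ℝ} (hM : M ∈ doublyStochastic ℝ n)
    {s : Set ℝ} {f : ℝ → ℝ} (hf : ConvexOn ℝ s f) {x : n → ℝ} (hx : ∀ i, x i ∈ s) :
    ∑ i, f ((M *ᵥ x) i) ≤ ∑ i, f (x i) :=
  calc ∑ i, f ((M *ᵥ x) i) ≤ ∑ i, ∑ j, M i j * f (x j) := Finset.sum_le_sum fun i _ =>
        hf.map_sum_le (fun _ _ => nonneg_of_mem_doublyStochastic hM)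
          (sum_row_of_mem_doublyStochastic hM i) fun j _ => hx j
    _ = ∑ j, f (x j) := by
        rw [Finset.sum_comm]
        simp_rw [← Finset.sum_mul, sum_col_of_mem_doublyStochastic hM, one_mul]

theorem map_norm_sq_mem_doublyStochastic {U : Matrix n n 𝕜} (hU : U ∈ unitaryGroup n 𝕜) :
    U.map (fun z => ‖z‖ ^ 2) ∈ doublyStochastic ℝ n := by
  refine mem_doublyStochastic_iff_sum.2 ⟨fun i j => sq_nonneg ‖U i j‖, fun i => ?_, fun j => ?_⟩
  · have h := congr_fun₂ (mem_unitaryGroup_iff.1 hU) i i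
    simp only [mul_apply, star_apply, one_apply_eq, RCLike.star_def, RCLike.mul_conj] at h
    exact_mod_cast h
  · have h := congr_fun₂ (mem_unitaryGroup_iff'.1 hU) j j
    simp only [mul_apply, star_apply, one_apply_eq, RCLike.star_def, RCLike.conj_mul] at h
    exact_mod_cast h

theorem re_mul_diagonal_mul_conjTranspose_apply_self (T : Matrix n n 𝕜) (x : n → ℝ) (i : n) :
    RCLike.re ((T * diagonal (RCLike.ofReal ∘ x : n → 𝕜) * Tᴴ : Matrix n n 𝕜) i i) =
      (T.map (fun z => ‖z‖ ^ 2) *ᵥ x) i := by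
  rw [mul_apply, map_sum]
  refine Finset.sum_congr rfl fun k _ => ?_
  rw [mul_diagonal, conjTranspose_apply, Function.comp_apply, RCLike.star_def,
    mul_right_comm, RCLike.mul_conj]
  norm_cast

theorem re_trace_cfc_eq_sum_eigenvalues {σ : Matrix n n 𝕜} (hσ : σ.IsHermitian) (f : ℝ → ℝ) :
    RCLike.re (cfc f σ).trace = ∑ i, f (hσ.eigenvalues i) := by
  rw [hσ.cfc_eq, IsHermitian.cfc, Unitary.conjStarAlgAut_apply, trace_mul_comm, ← mul_assoc]
  simp [trace]

theorem re_trace_cfc_submatrix_equiv {m : Type*} [Fintype m] [DecidableEq m] {σ : Matrix n n 𝕜}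
    (hσ : σ.IsHermitian) (f : ℝ → ℝ) (e : m ≃ n) :
    RCLike.re (cfc f (σ.submatrix e e)).trace = RCLike.re (cfc f σ).trace := by
  have hroots : (σ.submatrix e e).charpoly.roots = σ.charpoly.roots := by
    rw [← charpoly_reindex e.symm σ]
    rfl
  rw [(hσ.submatrix e).roots_charpoly_eq_eigenvalues, hσ.roots_charpoly_eq_eigenvalues] at hroots
  have hre := congr_arg (fun s => (s.map (f ∘ RCLike.re)).sum) hroots
  simpa [re_trace_cfc_eq_sum_eigenvalues, hσ, hσ.submatrix e] using hre

theorem sum_diag_conj_le_re_trace_cfc {σ : Matrix n n 𝕜} (hσ : σ.IsHermitian) {s : Set ℝ}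
    {f : ℝ → ℝ} (hf : ConvexOn ℝ s f) (hs : ∀ i, hσ.eigenvalues i ∈ s) {W : Matrix n n 𝕜}
    (hW : W ∈ unitaryGroup n 𝕜) :
    ∑ i, f (RCLike.re ((Wᴴ * σ * W) i i)) ≤ RCLike.re (cfc f σ).trace := by
  set T : Matrix n n 𝕜 := star W * hσ.eigenvectorUnitary with hT
  have hTU : T ∈ unitaryGroup n 𝕜 := mul_mem (Unitary.star_mem hW) hσ.eigenvectorUnitary.2
  have hconj : Wᴴ * σ * W = T * diagonal (RCLike.ofReal ∘ hσ.eigenvalues) * Tᴴ := by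
    conv_lhs => rw [hσ.spectral_theorem, Unitary.conjStarAlgAut_apply]
    simp only [hT, star_eq_conjTranspose, conjTranspose_mul, conjTranspose_conjTranspose, mul_assoc]
  simp only [hconj, re_mul_diagonal_mul_conjTranspose_apply_self]
  rw [re_trace_cfc_eq_sum_eigenvalues hσ]
  exact sum_map_mulVec_le_of_mem_doublyStochastic (map_norm_sq_mem_doublyStochastic hTU) hf hs

end Peierls

section PartialTrace

open Matrix
open scoped Kronecker

variable {a b R : Type*}

/-- The partial trace over the second tensor factor. -/
def partialTraceRight [Fintype b] [AddCommMonoid R] (ρ : Matrix (a × b) (a × b) R) : Matrix a a R :=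
  of fun x x' => ∑ y, ρ (x, y) (x', y)

/-- The partial trace over the first tensor factor. -/
def partialTraceLeft [Fintype a] [AddCommMonoid R] (ρ : Matrix (a × b) (a × b) R) : Matrix b b R :=
  of fun y y' => ∑ x, ρ (x, y) (x, y')

theorem trace_partialTraceRight [Fintype a] [Fintype b] [AddCommMonoid R]
    (ρ : Matrix (a × b) (a × b) R) : (partialTraceRight ρ).trace = ρ.trace :=
  (Fintype.sum_prod_type fun k => ρ k k).symm

theorem partialTraceRight_add [Fintype b] [AddCommMonoid R] (ρ σ : Matrix (a × b) (a × b) R) :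
    partialTraceRight (ρ + σ) = partialTraceRight ρ + partialTraceRight σ :=
  Matrix.ext fun _ _ => Finset.sum_add_distrib

theorem partialTraceRight_kronecker [Fintype b] [CommSemiring R] (A : Matrix a a R)
    (B : Matrix b b R) : partialTraceRight (A ⊗ₖ B) = B.trace • A := by
  ext x x'
  rw [Matrix.smul_apply, smul_eq_mul, mul_comm, trace, Finset.mul_sum]
  rfl

theorem partialTraceRight_kronecker_mul_mul_kronecker {a' b' : Type*} [Fintype a] [Fintype b]
    [Fintype b'] [DecidableEq b] [CommSemiring R] (A : Matrix a' a R) (C : Matrix a a' R)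
    {B : Matrix b' b R} {D : Matrix b b' R} (hDB : D * B = 1) (ρ : Matrix (a × b) (a × b) R) :
    partialTraceRight (A ⊗ₖ B * ρ * C ⊗ₖ D) = A * partialTraceRight ρ * C := by
  classical
  have hkron : ∀ (X : Matrix a a R) (Y : Matrix b b R),
      partialTraceRight (A ⊗ₖ B * X ⊗ₖ Y * C ⊗ₖ D) = A * partialTraceRight (X ⊗ₖ Y) * C :=
    fun X Y => by
      rw [← mul_kronecker_mul, ← mul_kronecker_mul, partialTraceRight_kronecker,
        partialTraceRight_kronecker, trace_mul_cycle, hDB, one_mul, Matrix.mul_smul,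
        Matrix.smul_mul]
  induction ρ using Matrix.induction_on' with
  | h_zero => simpa using hkron 0 0
  | h_add ρ σ hρ hσ => simp only [Matrix.mul_add, Matrix.add_mul, partialTraceRight_add, hρ, hσ]
  | h_std_basis k l r =>
    have hsingle : single k l r = single k.1 l.1 r ⊗ₖ single k.2 l.2 (1 : R) := by
      rw [single_kronecker_single, mul_one]
    rw [hsingle, hkron]

theorem partialTraceRight_submatrix_swap [Fintype a] [AddCommMonoid R]
    (ρ : Matrix (a × b) (a × b) R) :
    partialTraceRight (ρ.submatrix Prod.swap Prod.swap) = partialTraceLeft ρ :=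
  rfl

theorem submatrix_swap_kronecker {a' b' : Type*} [CommMagma R] (A : Matrix a a' R)
    (B : Matrix b b' R) : (A ⊗ₖ B).submatrix Prod.swap Prod.swap = B ⊗ₖ A :=
  Matrix.ext fun _ _ => mul_comm _ _

theorem partialTraceLeft_kronecker_mul_mul_kronecker {a' b' : Type*} [Fintype a] [Fintype b]
    [Fintype a'] [DecidableEq a] [CommSemiring R] (B : Matrix b' b R) (D : Matrix b b' R)
    {A : Matrix a' a R} {C : Matrix a a' R} (hCA : C * A = 1) (ρ : Matrix (a × b) (a × b) R) :
    partialTraceLeft (A ⊗ₖ B * ρ * C ⊗ₖ D) = B * partialTraceLeft ρ * D := by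
  have hswap : (A ⊗ₖ B * ρ * C ⊗ₖ D).submatrix Prod.swap Prod.swap =
      B ⊗ₖ A * ρ.submatrix Prod.swap Prod.swap * D ⊗ₖ C := by
    rw [← submatrix_swap_kronecker A B, ← submatrix_swap_kronecker C D]
    simp only [← Equiv.coe_prodComm, submatrix_mul_equiv]
  rw [← partialTraceRight_submatrix_swap, hswap,
    partialTraceRight_kronecker_mul_mul_kronecker _ _ hCA, partialTraceRight_submatrix_swap]

theorem isHermitian_partialTraceRight [Fintype b] [AddCommMonoid R] [StarAddMonoid R]
    {ρ : Matrix (a × b) (a × b) R} (hρ : ρ.IsHermitian) : (partialTraceRight ρ).IsHermitian := by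
  ext x x'
  simp only [partialTraceRight, conjTranspose_apply, of_apply, star_sum, hρ.apply]

theorem isHermitian_partialTraceLeft [Fintype a] [AddCommMonoid R] [StarAddMonoid R]
    {ρ : Matrix (a × b) (a × b) R} (hρ : ρ.IsHermitian) : (partialTraceLeft ρ).IsHermitian :=
  isHermitian_partialTraceRight (hρ.submatrix Prod.swap)

theorem sum_rpow_diag_partialTrace_le [Fintype a] [Fintype b] {𝕜 : Type*} [RCLike 𝕜]
    {ρ : Matrix (a × b) (a × b) 𝕜} (hdiag : ∀ k, 0 ≤ RCLike.re (ρ k k)) (htr : ρ.trace = 1) {q : ℝ}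
    (hq : 1 < q) :
    ∑ x, RCLike.re (partialTraceRight ρ x x) ^ q + ∑ y, RCLike.re (partialTraceLeft ρ y y) ^ q ≤
      1 + ∑ k, RCLike.re (ρ k k) ^ q := by
  obtain ⟨p, hp⟩ : ∃ p : a → b → NNReal, ∀ x y, RCLike.re (ρ (x, y) (x, y)) = p x y :=
    ⟨fun x y => ⟨RCLike.re (ρ (x, y) (x, y)), hdiag _⟩, fun _ _ => rfl⟩
  have hsum : ∑ x, ∑ y, p x y = 1 := by
    have hre := congr_arg RCLike.re htr
    simp only [trace, diag_apply, map_sum, Fintype.sum_prod_type, hp, RCLike.one_re] at hre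
    exact_mod_cast hre
  simp only [partialTraceRight, partialTraceLeft, of_apply, map_sum, Fintype.sum_prod_type, hp]
  exact_mod_cast sum_rpow_marginals_le hq p hsum

theorem exists_unitary_partialTrace_conj_eq_diagonal [Fintype a] [Fintype b] [DecidableEq a]
    [DecidableEq b] {𝕜 : Type*} [RCLike 𝕜] {ρ : Matrix (a × b) (a × b) 𝕜}
    (hR : (partialTraceRight ρ).IsHermitian) (hL : (partialTraceLeft ρ).IsHermitian) :
    ∃ W ∈ unitaryGroup (a × b) 𝕜,
      partialTraceRight (Wᴴ * ρ * W) = diagonal (RCLike.ofReal ∘ hR.eigenvalues) ∧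
      partialTraceLeft (Wᴴ * ρ * W) = diagonal (RCLike.ofReal ∘ hL.eigenvalues) := by
  refine ⟨hR.eigenvectorUnitary ⊗ₖ hL.eigenvectorUnitary,
    kronecker_mem_unitary hR.eigenvectorUnitary.2 hL.eigenvectorUnitary.2, ?_, ?_⟩
  · rw [conjTranspose_kronecker, ← star_eq_conjTranspose, ← star_eq_conjTranspose,
      partialTraceRight_kronecker_mul_mul_kronecker _ _
        (mem_unitaryGroup_iff.1 hL.eigenvectorUnitary.2),
      ← hR.conjStarAlgAut_star_eigenvectorUnitary, Unitary.conjStarAlgAut_star_apply]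
  · rw [conjTranspose_kronecker, ← star_eq_conjTranspose, ← star_eq_conjTranspose,
      partialTraceLeft_kronecker_mul_mul_kronecker _ _
        (mem_unitaryGroup_iff.1 hR.eigenvectorUnitary.2),
      ← hL.conjStarAlgAut_star_eigenvectorUnitary, Unitary.conjStarAlgAut_star_apply]

theorem re_trace_cfc_rpow_partialTrace_le [Fintype a] [Fintype b] [DecidableEq a] [DecidableEq b]
    {𝕜 : Type*} [RCLike 𝕜] {ρ : Matrix (a × b) (a × b) 𝕜} (hρ : ρ.PosSemidef) (htr : ρ.trace = 1)
    {q : ℝ} (hq : 1 < q) :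
    RCLike.re (cfc (fun x : ℝ => x ^ q) (partialTraceRight ρ)).trace +
        RCLike.re (cfc (fun x : ℝ => x ^ q) (partialTraceLeft ρ)).trace ≤
      1 + RCLike.re (cfc (fun x : ℝ => x ^ q) ρ).trace := by
  have hR : (partialTraceRight ρ).IsHermitian := isHermitian_partialTraceRight hρ.1
  have hL : (partialTraceLeft ρ).IsHermitian := isHermitian_partialTraceLeft hρ.1
  obtain ⟨W, hW, hWR, hWL⟩ := exists_unitary_partialTrace_conj_eq_diagonal hR hL
  have hdiag : ∀ k, 0 ≤ RCLike.re ((Wᴴ * ρ * W) k k) := fun _ =>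
    (RCLike.nonneg_iff.1 (hρ.conjTranspose_mul_mul_same W).diag_nonneg).1
  have htrW : (Wᴴ * ρ * W).trace = 1 := by
    rw [trace_mul_cycle, ← star_eq_conjTranspose, mem_unitaryGroup_iff.1 hW, one_mul, htr]
  have hclassical := sum_rpow_diag_partialTrace_le hdiag htrW hq
  simp only [hWR, hWL, diagonal_apply_eq, Function.comp_apply, RCLike.ofReal_re] at hclassical
  rw [re_trace_cfc_eq_sum_eigenvalues hR, re_trace_cfc_eq_sum_eigenvalues hL]
  exact hclassical.trans <| by
    gcongr
    exact sum_diag_conj_le_re_trace_cfc hρ.1 (convexOn_rpow hq.le) hρ.eigenvalues_nonneg hW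

end PartialTrace

theorem tsallisEntropy_submatrix_equiv {a c : Type*} [Fintype a] [Fintype c] [DecidableEq a]
    [DecidableEq c] (q : ℝ) {σ : Matrix a a ℂ} (hσ : σ.IsHermitian) (e : c ≃ a) :
    tsallisEntropy q (σ.submatrix e e) = tsallisEntropy q σ := by
  have htrace : (cfc (fun x : ℝ => x ^ q) (σ.submatrix e e)).trace.re =
      (cfc (fun x : ℝ => x ^ q) σ).trace.re := re_trace_cfc_submatrix_equiv hσ _ e
  rw [tsallisEntropy, htrace, tsallisEntropy]

theorem tsallisEntropy_le_partialTrace_add {a b : Type*} [Fintype a] [Fintype b] [DecidableEq a]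
    [DecidableEq b] {q : ℝ} (hq : 1 < q) {ρ : Matrix (a × b) (a × b) ℂ}
    (hρ : IsDensityOperator ρ) :
    tsallisEntropy q ρ ≤
      tsallisEntropy q (partialTraceRight ρ) + tsallisEntropy q (partialTraceLeft ρ) := by
  have htrace : (cfc (fun x : ℝ => x ^ q) (partialTraceRight ρ)).trace.re +
      (cfc (fun x : ℝ => x ^ q) (partialTraceLeft ρ)).trace.re ≤
        1 + (cfc (fun x : ℝ => x ^ q) ρ).trace.re :=
    re_trace_cfc_rpow_partialTrace_le hρ.posSemidef hρ.trace_eq_one hq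
  simp only [tsallisEntropy, ← mul_add]
  exact mul_le_mul_of_nonpos_left (by linarith) (one_div_nonpos.2 (by linarith))

section Marginal

variable {ι : Type*} [Fintype ι] [DecidableEq ι] {d : ι → Type*} [∀ i, Fintype (d i)]
  {ρ : Matrix (∀ i, d i) (∀ i, d i) ℂ}

theorem isDensityOperator_marginal (hρ : IsDensityOperator ρ) (J : Finset ι) :
    IsDensityOperator (marginal ρ J) where
  posSemidef := by
    have hsum : marginal ρ J = ∑ z : (∀ i : {i // i ∉ J}, d i),
        ρ.submatrix (fun x => (Equiv.piEquivPiSubtypeProd (fun i => i ∈ J) d).symm (x, z))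
          (fun x => (Equiv.piEquivPiSubtypeProd (fun i => i ∈ J) d).symm (x, z)) := by
      ext x y
      rw [Matrix.sum_apply]
      rfl
    rw [hsum]
    exact Matrix.posSemidef_sum _ fun z _ => hρ.posSemidef.submatrix _
  trace_eq_one := by
    rw [← hρ.trace_eq_one]
    simp only [Matrix.trace, Matrix.diag_apply, marginal]
    rw [← (Equiv.piEquivPiSubtypeProd (fun i => i ∈ J) d).symm.sum_comp, Fintype.sum_prod_type]

-- `g` is abstract so that the parts `s` and `t` may be glued in either order.
theorem sum_marginal_apply_glue (ρ : Matrix (∀ i, d i) (∀ i, d i) ℂ) {s t u : Finset ι}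
    (hst : Disjoint s t) (hu : ∀ i, i ∈ u ↔ i ∈ s ∨ i ∈ t)
    (g : (∀ i : {i // i ∈ s}, d i) → (∀ i : {i // i ∈ t}, d i) → ∀ i : {i // i ∈ u}, d i)
    (hgs : ∀ x y i (hi : i ∈ s) (hiu : i ∈ u), g x y ⟨i, hiu⟩ = x ⟨i, hi⟩)
    (hgt : ∀ x y i (hi : i ∈ t) (hiu : i ∈ u), g x y ⟨i, hiu⟩ = y ⟨i, hi⟩)
    (x x' : ∀ i : {i // i ∈ s}, d i) :
    ∑ y, marginal ρ u (g x y) (g x' y) = marginal ρ s x x' := by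
  have hts : ∀ i ∈ t, i ∉ s := fun i hi hs => Finset.disjoint_left.1 hst hs hi
  let join (k : (∀ i : {i // i ∈ t}, d i) × (∀ i : {i // i ∉ u}, d i)) (i : {i // i ∉ s}) : d i :=
    if hi : ↑i ∈ t then k.1 ⟨i, hi⟩ else k.2 ⟨i, fun h => ((hu i).1 h).elim i.2 hi⟩
  let split (w : ∀ i : {i // i ∉ s}, d i) :
      (∀ i : {i // i ∈ t}, d i) × (∀ i : {i // i ∉ u}, d i) :=
    (fun i => w ⟨i, hts i i.2⟩, fun i => w ⟨i, fun h => i.2 ((hu i).2 (.inl h))⟩)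
  have hglue : ∀ x k, (Equiv.piEquivPiSubtypeProd (· ∈ u) d).symm (g x k.1, k.2) =
      (Equiv.piEquivPiSubtypeProd (· ∈ s) d).symm (x, join k) := fun x k => by
    ext i
    by_cases hs : i ∈ s
    · have hiu := (hu i).2 (.inl hs)
      simp [hs, hiu, hgs _ _ i hs]
    · by_cases ht : i ∈ t
      · have hiu := (hu i).2 (.inr ht)
        simp [hs, ht, hiu, join, hgt _ _ i ht]
      · simp [hs, ht, (hu i).not.2 (by tauto), join]
  simp only [marginal, ← Fintype.sum_prod_type']
  refine Finset.sum_nbij' join split (by simp) (by simp) (fun k _ => ?_) (fun w _ => ?_)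
    fun k _ => by rw [hglue, hglue]
  · ext i
    · simp [join, split]
    · simp [join, split, mt (fun h => (hu i).2 (.inr h)) i.2]
  · ext i
    by_cases ht : (i : ι) ∈ t <;> simp [join, split, ht]

variable {s t : Finset ι}

theorem partialTraceRight_marginal_union (ρ : Matrix (∀ i, d i) (∀ i, d i) ℂ)
    (hst : Disjoint s t) :
    partialTraceRight ((marginal ρ (s ∪ t)).submatrix (Equiv.piFinsetUnion d hst)
      (Equiv.piFinsetUnion d hst)) = marginal ρ s :=
  Matrix.ext <| sum_marginal_apply_glue ρ hst (fun _ => Finset.mem_union)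
    (fun x y => Equiv.piFinsetUnion d hst (x, y))
    (fun _ _ _ hi hiu => Equiv.piFinsetUnion_left d hst hi hiu)
    (fun _ _ _ hi hiu => Equiv.piFinsetUnion_right d hst hi hiu)

theorem partialTraceLeft_marginal_union (ρ : Matrix (∀ i, d i) (∀ i, d i) ℂ)
    (hst : Disjoint s t) :
    partialTraceLeft ((marginal ρ (s ∪ t)).submatrix (Equiv.piFinsetUnion d hst)
      (Equiv.piFinsetUnion d hst)) = marginal ρ t :=
  Matrix.ext <| sum_marginal_apply_glue ρ hst.symm (fun _ => Finset.mem_union.trans or_comm)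
    (fun y x => Equiv.piFinsetUnion d hst (x, y))
    (fun _ _ _ hi hiu => Equiv.piFinsetUnion_right d hst hi hiu)
    (fun _ _ _ hi hiu => Equiv.piFinsetUnion_left d hst hi hiu)

variable [∀ i, DecidableEq (d i)] {q : ℝ}

theorem subsystemEntropy_union_le (hq : 1 < q) (hρ : IsDensityOperator ρ) (hst : Disjoint s t) :
    subsystemEntropy q ρ (s ∪ t) ≤ subsystemEntropy q ρ s + subsystemEntropy q ρ t := by
  have hunion := isDensityOperator_marginal hρ (s ∪ t)
  have hdensity : IsDensityOperator ((marginal ρ (s ∪ t)).submatrix (Equiv.piFinsetUnion d hst)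
      (Equiv.piFinsetUnion d hst)) :=
    ⟨hunion.posSemidef.submatrix _, by
      rw [← trace_partialTraceRight, partialTraceRight_marginal_union,
        (isDensityOperator_marginal hρ s).trace_eq_one]⟩
  simpa only [subsystemEntropy, partialTraceRight_marginal_union, partialTraceLeft_marginal_union,
    tsallisEntropy_submatrix_equiv q hunion.posSemidef.isHermitian] using
    tsallisEntropy_le_partialTrace_add hq hdensity

theorem subsystemEntropy_empty (hρ : IsDensityOperator ρ) (q : ℝ) :
    subsystemEntropy q ρ ∅ = 0 := by
  have hone : marginal ρ ∅ = 1 := by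
    have htrace := (isDensityOperator_marginal hρ ∅).trace_eq_one
    rw [Matrix.trace, Fintype.sum_unique] at htrace
    ext x y
    rwa [Subsingleton.elim x default, Subsingleton.elim y default, Matrix.one_apply_eq]
  simp [subsystemEntropy, tsallisEntropy, hone, cfc_apply_one]

theorem totalCorrelation_empty (hρ : IsDensityOperator ρ) (q : ℝ) : totalCorrelation q ρ ∅ = 0 := by
  simp [totalCorrelation, subsystemEntropy_empty hρ]

theorem totalCorrelation_singleton (q : ℝ) (ρ : Matrix (∀ i, d i) (∀ i, d i) ℂ) (v : ι) :
    totalCorrelation q ρ {v} = 0 := by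
  simp [totalCorrelation]

theorem totalCorrelation_mono (hq : 1 < q) (hρ : IsDensityOperator ρ) :
    Monotone (totalCorrelation q ρ) :=
  Finset.monotone_iff_forall_le_insert.2 fun I v hv => by
    have hsub := subsystemEntropy_union_le hq hρ (Finset.disjoint_singleton_left.2 hv)
    rw [← Finset.insert_eq] at hsub
    rw [totalCorrelation, totalCorrelation, Finset.sum_insert hv]
    linarith

end Marginal

open Finset MeasureTheory Filter
open scoped Topology

section Homology

/-- The incidence number of the facet `J.erase v` in the oriented simplex `J`. It is also used for
`v ∉ J`, where it is the sign picked up when `v` is inserted into `J` as a new vertex. -/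
def faceSign (R : Type*) [Ring R] {ι : Type*} [LinearOrder ι] (J : Finset ι) (v : ι) : R :=
  (-1) ^ #{u ∈ J | u < v}

theorem faceSign_mul_self {R : Type*} [Ring R] {ι : Type*} [LinearOrder ι] (J : Finset ι) (v : ι) :
    faceSign R J v * faceSign R J v = 1 := by
  rw [faceSign, ← pow_add, Even.neg_one_pow ⟨_, rfl⟩]

theorem faceSign_eq_ite_erase {R : Type*} [Ring R] {ι : Type*} [LinearOrder ι] {J : Finset ι}
    {v : ι} (hv : v ∈ J) (w : ι) :
    faceSign R J w = if v < w then -faceSign R (J.erase v) w else faceSign R (J.erase v) w := by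
  rw [faceSign, faceSign, filter_erase]
  split_ifs with h
  · rw [← card_erase_add_one (mem_filter.2 ⟨hv, h⟩), pow_succ, mul_neg_one]
  · rw [erase_eq_of_notMem (s := {u ∈ J | u < w}) fun hmem => h (mem_filter.1 hmem).2]

theorem faceSign_mul_faceSign_erase_add {R : Type*} [CommRing R] {ι : Type*} [LinearOrder ι]
    {J : Finset ι} {v w : ι} (hv : v ∈ J) (hw : w ∈ J) (hvw : v ≠ w) :
    faceSign R J v * faceSign R (J.erase v) w + faceSign R J w * faceSign R (J.erase w) v = 0 := by
  rw [faceSign_eq_ite_erase hv w, faceSign_eq_ite_erase hw v]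
  rcases hvw.lt_or_gt with h | h <;> simp only [h, h.not_gt, if_true, if_false] <;> ring

theorem faceSign_mul_faceSign_insert_add {R : Type*} [CommRing R] {ι : Type*} [LinearOrder ι]
    {J : Finset ι} {v a : ι} (hv : v ∈ J) (ha : a ∉ J) :
    faceSign R J a * faceSign R (insert a J) v + faceSign R J v * faceSign R (J.erase v) a = 0 := by
  rw [faceSign_eq_ite_erase (mem_insert_self a J) v, erase_insert ha, faceSign_eq_ite_erase hv a]
  rcases (ne_of_mem_of_not_mem hv ha).lt_or_gt with h | h <;>
    simp only [h, h.not_gt, if_true, if_false] <;> ring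

theorem single_mem_augmentedChains {K : Type*} [Field K] {ι : Type*} [DecidableEq ι]
    {G : PreAbstractSimplicialComplex ι} {J : Finset ι} (hJ : J = ∅ ∨ J ∈ G.faces) (r : K) :
    Pi.single J r ∈ augmentedChains K G #J := by
  intro I hI
  obtain rfl : I = J := by
    by_contra h
    exact hI (Pi.single_eq_of_ne (M := fun _ => K) h r)
  exact ⟨hJ, rfl⟩

theorem map_augmentedChains_le {K : Type*} [Field K] {ι : Type*} [Finite ι] [DecidableEq ι]
    {G : PreAbstractSimplicialComplex ι} {m : ℕ} {f : (Finset ι → K) →ₗ[K] (Finset ι → K)}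
    {P : Submodule K (Finset ι → K)}
    (h : ∀ J : Finset ι, (J = ∅ ∨ J ∈ G.faces) → #J = m → f (Pi.single J 1) ∈ P) :
    (augmentedChains K G m).map f ≤ P := by
  have := Fintype.ofFinite ι
  rintro _ ⟨c, hc, rfl⟩
  rw [f.pi_apply_eq_sum_univ]
  refine P.sum_mem fun J _ => ?_
  by_cases hcJ : c J = 0
  · simp [hcJ]
  · convert P.smul_mem (c J) (h J (hc J hcJ).1 (hc J hcJ).2) using 3
    ext I
    simp [Pi.single_apply, eq_comm]

theorem finrank_augmentedChains (K : Type*) [Field K] {ι : Type*} [Finite ι]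
    (G : PreAbstractSimplicialComplex ι) (m : ℕ) :
    Module.finrank K (augmentedChains K G m) =
      {J : Finset ι | (J = ∅ ∨ J ∈ G.faces) ∧ #J = m}.ncard := by
  classical
  have := Fintype.ofFinite ι
  set S := {J : Finset ι | (J = ∅ ∨ J ∈ G.faces) ∧ #J = m}
  have hker : augmentedChains K G m = ⨅ J ∈ Sᶜ, LinearMap.ker (LinearMap.proj J) := by
    ext c
    simp only [Submodule.mem_iInf, LinearMap.mem_ker, LinearMap.proj_apply]
    exact forall_congr' fun J => not_imp_comm
  rw [hker, (LinearMap.iInfKerProjEquiv K (fun _ => K) (disjoint_compl_right (a := S))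
    (Set.union_compl_self S).ge).finrank_eq, Module.finrank_fintype_fun_eq_card,
    ← Nat.card_eq_fintype_card, Nat.card_coe_set_eq]

theorem finrank_augmentedChains_zero (K : Type*) [Field K] {ι : Type*} [Finite ι]
    (G : PreAbstractSimplicialComplex ι) : Module.finrank K (augmentedChains K G 0) = 1 := by
  rw [finrank_augmentedChains, Set.ncard_eq_one]
  refine ⟨∅, Set.ext fun J => ?_⟩
  simp +contextual [and_iff_right_of_imp]

theorem augmentedChains_eq_bot (K : Type*) [Field K] {ι : Type*} [Fintype ι]
    (G : PreAbstractSimplicialComplex ι) {m : ℕ} (hm : Fintype.card ι < m) :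
    augmentedChains K G m = ⊥ :=
  (Submodule.eq_bot_iff _).2 fun c hc => funext fun J => by
    by_contra h
    exact hm.not_ge ((hc J h).2 ▸ J.card_le_univ)

theorem sum_range_neg_one_pow_mul_finrank_augmentedChains (K : Type*) [Field K] {ι : Type*}
    [Fintype ι] (G : PreAbstractSimplicialComplex ι) [DecidablePred (· ∈ G.faces)] :
    ∑ k ∈ range (Fintype.card ι), (-1 : ℤ) ^ k * Module.finrank K (augmentedChains K G (k + 1)) =
      ∑ J with J ∈ G.faces, (-1) ^ (#J + 1) := by
  have hcard : ∀ J ∈ G.faces, #J = #J - 1 + 1 := fun J hJ =>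
    (Nat.sub_add_cancel (card_pos.2 (G.isRelLowerSet_faces hJ).1)).symm
  have hmaps : ∀ J ∈ ({J | J ∈ G.faces} : Finset (Finset ι)), #J - 1 ∈ range (Fintype.card ι) :=
    fun J hJ => mem_range.2 (by have := hcard J (by simpa using hJ); have := J.card_le_univ; omega)
  rw [← sum_fiberwise_of_maps_to hmaps]
  refine sum_congr rfl fun k _ => ?_
  have hfaces : {J : Finset ι | (J = ∅ ∨ J ∈ G.faces) ∧ #J = k + 1} =
      ({J ∈ ({J | J ∈ G.faces} : Finset (Finset ι)) | #J - 1 = k} : Finset (Finset ι)) := by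
    ext J
    have := hcard J
    have hne : J = ∅ → #J = 0 := fun h => h ▸ card_empty
    simp only [Set.mem_ofPred_eq, coe_filter, mem_filter, mem_univ, true_and]
    grind
  rw [finrank_augmentedChains, hfaces, Set.ncard_coe_finset, mul_comm, ← nsmul_eq_mul, ← sum_const]
  refine sum_congr rfl fun J hJ => ?_
  obtain ⟨hJG, rfl⟩ : J ∈ G.faces ∧ #J - 1 = k := by simpa using hJ
  rw [hcard J hJG, Nat.add_sub_cancel, pow_add _ _ 1, pow_succ, pow_one, mul_assoc]
  simp

variable {K : Type*} [Field K] {ι : Type*} [Fintype ι] [LinearOrder ι]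

theorem simplicialBoundary_single (J : Finset ι) (r : K) :
    simplicialBoundary K ι (Pi.single J r) =
      ∑ v ∈ J, Pi.single (J.erase v) (r * faceSign K J v) := by
  simp only [simplicialBoundary, Fintype.linearCombination_apply_single, smul_sum, ← Pi.single_smul,
    smul_eq_mul, faceSign]

theorem simplicialBoundary_comp_self :
    simplicialBoundary K ι ∘ₗ simplicialBoundary K ι = 0 := by
  refine LinearMap.pi_ext' fun J => LinearMap.ext_ring ?_
  simp only [LinearMap.comp_apply, LinearMap.single_apply, LinearMap.zero_apply,
    simplicialBoundary_single, map_sum, one_mul]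
  rw [sum_sigma']
  refine sum_involution (fun p _ => ⟨p.2, p.1⟩) ?_ ?_ ?_ fun _ _ => rfl
  · rintro ⟨v, w⟩ h
    obtain ⟨hv, hwv, hw⟩ : v ∈ J ∧ w ≠ v ∧ w ∈ J := by simpa using h
    rw [erase_right_comm, ← Pi.single_add, faceSign_mul_faceSign_erase_add hv hw hwv.symm,
      Pi.single_zero]
  · rintro ⟨v, w⟩ h - heq
    exact (mem_erase.1 (mem_sigma.1 h).2).1 (congrArg Sigma.fst heq)
  · rintro ⟨v, w⟩ h
    simp only [mem_sigma, mem_erase] at h ⊢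
    exact ⟨h.2.2, h.2.1.symm, h.1⟩

theorem map_simplicialBoundary_le (G : PreAbstractSimplicialComplex ι) (m : ℕ) :
    (augmentedChains K G (m + 1)).map (simplicialBoundary K ι) ≤ augmentedChains K G m := by
  refine map_augmentedChains_le fun J hJ hm => ?_
  rw [simplicialBoundary_single]
  refine Submodule.sum_mem _ fun v hv => ?_
  have hface : J.erase v = ∅ ∨ J.erase v ∈ G.faces :=
    (J.erase v).eq_empty_or_nonempty.imp_right <|
      (G.isRelLowerSet_faces (hJ.resolve_left (ne_empty_of_mem hv))).2 (erase_subset v J)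
  obtain rfl : #(J.erase v) = m := by rw [card_erase_of_mem hv, hm, Nat.add_sub_cancel]
  exact single_mem_augmentedChains hface _

theorem map_simplicialBoundary_one {G : PreAbstractSimplicialComplex ι} (hG : G.faces.Nonempty) :
    (augmentedChains K G 1).map (simplicialBoundary K ι) = augmentedChains K G 0 := by
  obtain ⟨J, hJ⟩ := hG
  obtain ⟨v, hv⟩ := (G.isRelLowerSet_faces hJ).1
  have hvertex : {v} ∈ G.faces :=
    (G.isRelLowerSet_faces hJ).2 (singleton_subset_iff.2 hv) (singleton_nonempty v)
  refine le_antisymm (map_simplicialBoundary_le G 0) fun c hc => ?_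
  refine ⟨Pi.single {v} (c ∅), single_mem_augmentedChains (.inr hvertex) _, ?_⟩
  ext I
  by_cases hI : I = ∅
  · simp [hI, simplicialBoundary_single, faceSign, filter_singleton]
  · have hcI : c I = 0 := by
      by_contra h
      exact hI (card_eq_zero.1 (hc I h).2)
    simp [hI, hcI, simplicialBoundary_single]

theorem reducedBoundaries_le_reducedCycles (G : PreAbstractSimplicialComplex ι) (k : ℕ) :
    reducedBoundaries K G k ≤ reducedCycles K G k := by
  refine le_inf (map_simplicialBoundary_le G (k + 1)) ?_
  rintro _ ⟨c, -, rfl⟩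
  exact LinearMap.congr_fun simplicialBoundary_comp_self c

theorem finrank_reducedCycles_add (G : PreAbstractSimplicialComplex ι) (k : ℕ) :
    Module.finrank K (reducedCycles K G k) +
      Module.finrank K ((augmentedChains K G (k + 1)).map (simplicialBoundary K ι)) =
      Module.finrank K (augmentedChains K G (k + 1)) := by
  have hker : LinearMap.ker ((simplicialBoundary K ι).domRestrict (augmentedChains K G (k + 1))) =
      (reducedCycles K G k).submoduleOf (augmentedChains K G (k + 1)) := by
    ext x
    simp [reducedCycles, Submodule.submoduleOf]
  have hle : reducedCycles K G k ≤ augmentedChains K G (k + 1) := inf_le_left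
  rw [← (Submodule.submoduleOfEquivOfLe hle).finrank_eq, ← hker,
    ← LinearMap.range_domRestrict, add_comm]
  exact LinearMap.finrank_range_add_finrank_ker _

theorem finrank_reducedHomology_add (G : PreAbstractSimplicialComplex ι) (k : ℕ) :
    Module.finrank K (ReducedHomology K G k) + Module.finrank K (reducedBoundaries K G k) =
      Module.finrank K (reducedCycles K G k) := by
  rw [← (Submodule.submoduleOfEquivOfLe (reducedBoundaries_le_reducedCycles G k)).finrank_eq]
  exact Submodule.finrank_quotient_add_finrank _

theorem finrank_reducedHomology_le (G : PreAbstractSimplicialComplex ι) (k : ℕ) :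
    Module.finrank K (ReducedHomology K G k) ≤ Module.finrank K (augmentedChains K G (k + 1)) := by
  have hhomology := finrank_reducedHomology_add (K := K) G k
  have hcycles := finrank_reducedCycles_add (K := K) G k
  omega

theorem finrank_reducedHomology_eq_zero_of_card_le (G : PreAbstractSimplicialComplex ι) {k : ℕ}
    (hk : Fintype.card ι ≤ k) : Module.finrank K (ReducedHomology K G k) = 0 := by
  have hle := finrank_reducedHomology_le (K := K) G k
  rwa [augmentedChains_eq_bot K G (Nat.lt_succ_of_le hk), finrank_bot, Nat.le_zero] at hle

theorem sum_range_neg_one_pow_mul_finrank_reducedHomology (G : PreAbstractSimplicialComplex ι)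
    (N : ℕ) :
    ∑ k ∈ range N, (-1 : ℤ) ^ k * Module.finrank K (ReducedHomology K G k) =
      ∑ k ∈ range N, (-1 : ℤ) ^ k * Module.finrank K (augmentedChains K G (k + 1))
        - Module.finrank K ((augmentedChains K G 1).map (simplicialBoundary K ι))
        + (-1) ^ N *
          Module.finrank K ((augmentedChains K G (N + 1)).map (simplicialBoundary K ι)) := by
  induction N with
  | zero => simp
  | succ N ih =>
    have hhomology : (Module.finrank K (ReducedHomology K G N) : ℤ) +
        Module.finrank K ((augmentedChains K G (N + 2)).map (simplicialBoundary K ι)) =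
          Module.finrank K (reducedCycles K G N) :=
      mod_cast finrank_reducedHomology_add G N
    have hcycles : (Module.finrank K (reducedCycles K G N) : ℤ) +
        Module.finrank K ((augmentedChains K G (N + 1)).map (simplicialBoundary K ι)) =
          Module.finrank K (augmentedChains K G (N + 1)) :=
      mod_cast finrank_reducedCycles_add G N
    rw [sum_range_succ, sum_range_succ, ih, ← hcycles, ← hhomology, pow_succ]
    ring

theorem reduced_euler_poincare {G : PreAbstractSimplicialComplex ι} [DecidablePred (· ∈ G.faces)]
    (hG : G.faces.Nonempty) :
    ∑ k ∈ range (Fintype.card ι), (-1 : ℤ) ^ k * Module.finrank K (ReducedHomology K G k) =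
      ∑ J with J ∈ G.faces, (-1) ^ (#J + 1) - 1 := by
  rw [sum_range_neg_one_pow_mul_finrank_reducedHomology, map_simplicialBoundary_one hG,
    finrank_augmentedChains_zero, augmentedChains_eq_bot K G (Nat.lt_succ_self _),
    Submodule.map_bot, finrank_bot, sum_range_neg_one_pow_mul_finrank_augmentedChains]
  simp

/-- The join with the vertex `a` as a linear operator on formal combinations of sets of vertices.
The sign moves `a`, which comes first in the join, to its place in the order of the vertices. -/
noncomputable def coneOperator (K : Type*) [Field K] (a : ι) :
    (Finset ι → K) →ₗ[K] (Finset ι → K) :=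
  Fintype.linearCombination K fun J : Finset ι =>
    if a ∈ J then 0 else Pi.single (insert a J) (faceSign K J a)

theorem coneOperator_single_of_mem {a : ι} {J : Finset ι} (ha : a ∈ J) (r : K) :
    coneOperator K a (Pi.single J r) = 0 := by
  rw [coneOperator, Fintype.linearCombination_apply_single, if_pos ha, smul_zero]

theorem coneOperator_single_of_notMem {a : ι} {J : Finset ι} (ha : a ∉ J) (r : K) :
    coneOperator K a (Pi.single J r) = Pi.single (insert a J) (r * faceSign K J a) := by
  rw [coneOperator, Fintype.linearCombination_apply_single, if_neg ha, ← Pi.single_smul,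
    smul_eq_mul]

theorem simplicialBoundary_comp_coneOperator_add (a : ι) :
    simplicialBoundary K ι ∘ₗ coneOperator K a + coneOperator K a ∘ₗ simplicialBoundary K ι =
      LinearMap.id := by
  refine LinearMap.pi_ext' fun J => LinearMap.ext_ring ?_
  simp only [LinearMap.comp_apply, LinearMap.single_apply, LinearMap.add_apply, LinearMap.id_apply,
    simplicialBoundary_single, map_sum, one_mul]
  by_cases ha : a ∈ J
  · have hsign : faceSign K J a = faceSign K (J.erase a) a := by
      rw [faceSign_eq_ite_erase ha, if_neg (lt_irrefl a)]
    rw [coneOperator_single_of_mem ha, map_zero, zero_add, sum_eq_single_of_mem a ha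
        fun v _ hv => coneOperator_single_of_mem (mem_erase.2 ⟨hv.symm, ha⟩) _,
      coneOperator_single_of_notMem (notMem_erase a J), insert_erase ha, hsign, faceSign_mul_self]
  · have hsign : faceSign K (insert a J) a = faceSign K J a := by
      rw [faceSign_eq_ite_erase (mem_insert_self a J), if_neg (lt_irrefl a), erase_insert ha]
    rw [coneOperator_single_of_notMem ha, one_mul, simplicialBoundary_single, sum_insert ha,
      erase_insert ha, hsign, faceSign_mul_self, add_assoc, ← sum_add_distrib, sum_eq_zero,
      add_zero]
    intro v hv
    rw [coneOperator_single_of_notMem fun h => ha (mem_of_mem_erase h),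
      erase_insert_of_ne (ne_of_mem_of_not_mem hv ha).symm, ← Pi.single_add,
      faceSign_mul_faceSign_insert_add hv ha, Pi.single_zero]

theorem map_coneOperator_le {G : PreAbstractSimplicialComplex ι} {a : ι} (ha : {a} ∈ G.faces)
    (hcone : ∀ J ∈ G.faces, insert a J ∈ G.faces) (m : ℕ) :
    (augmentedChains K G m).map (coneOperator K a) ≤ augmentedChains K G (m + 1) := by
  refine map_augmentedChains_le fun J hJ hm => ?_
  by_cases haJ : a ∈ J
  · rw [coneOperator_single_of_mem haJ]
    exact zero_mem _
  · rw [coneOperator_single_of_notMem haJ, ← hm, ← card_insert_of_notMem haJ]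
    refine single_mem_augmentedChains (.inr ?_) _
    rcases hJ with rfl | hJ
    exacts [ha, hcone J hJ]

theorem finrank_reducedHomology_eq_zero_of_cone {G : PreAbstractSimplicialComplex ι} {a : ι}
    (ha : {a} ∈ G.faces) (hcone : ∀ J ∈ G.faces, insert a J ∈ G.faces) (k : ℕ) :
    Module.finrank K (ReducedHomology K G k) = 0 := by
  have hle : reducedCycles K G k ≤ reducedBoundaries K G k := fun c hc =>
    ⟨coneOperator K a c, map_coneOperator_le ha hcone _ (Submodule.mem_map_of_mem hc.1), by
      simpa [LinearMap.mem_ker.1 hc.2] using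
        LinearMap.congr_fun (simplicialBoundary_comp_coneOperator_add (K := K) a) c⟩
  have hhomology := finrank_reducedHomology_add (K := K) G k
  have hmono := Submodule.finrank_mono hle
  omega

end Homology

theorem sum_neg_one_pow_card_nonempty (ι : Type*) [Fintype ι] [Nonempty ι] :
    ∑ J : Finset ι with J.Nonempty, (-1 : ℤ) ^ #J = -1 := by
  classical
  have hall := sum_powerset_neg_one_pow_card_of_nonempty (univ_nonempty (α := ι))
  rw [powerset_univ, ← sum_filter_add_sum_filter_not _ Finset.Nonempty] at hall
  simpa [not_nonempty_iff_eq_empty, filter_eq', add_eq_zero_iff_eq_neg] using hall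

section Filtration

variable {K : Type*} [Field K] {ι : Type*} [Fintype ι] [LinearOrder ι] {F : Finset ι → ℝ}

theorem measurable_reducedBetti (hF : IsMonotoneFunctional F) (k : ℕ) :
    Measurable (reducedBetti K F hF k) := by
  have hfac : (reducedBetti K F hF k).FactorsThrough fun t J => F J ≤ t := fun t u htu => by
    have hcomplex : sublevelComplex F hF t = sublevelComplex F hF u := by
      ext J
      exact and_congr_right fun _ => iff_of_eq (congr_fun htu J)
    rw [reducedBetti, hcomplex, reducedBetti]
  obtain ⟨e, he⟩ := (Function.factorsThrough_iff _).1 hfac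
  rw [he]
  exact (measurable_of_finite e).comp <| measurable_pi_lambda _ fun J =>
    measurableSet_setOfPred.1 (measurableSet_Ici (a := F J))

theorem reducedBetti_le_card (hF : IsMonotoneFunctional F) (k : ℕ) (t : ℝ) :
    reducedBetti K F hF k t ≤ Fintype.card (Finset ι) :=
  (finrank_reducedHomology_le _ k).trans <|
    (Submodule.finrank_le _).trans (Module.finrank_fintype_fun_eq_card K).le

theorem reducedBetti_eq_zero_of_univ_le [Nonempty ι] (hF : IsMonotoneFunctional F) (k : ℕ) {t : ℝ}
    (ht : F univ ≤ t) : reducedBetti K F hF k t = 0 := by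
  have hfull : ∀ J : Finset ι, J.Nonempty → J ∈ (sublevelComplex F hF t).faces := fun J hJ =>
    ⟨hJ, (hF J univ hJ (subset_univ J)).trans ht⟩
  exact finrank_reducedHomology_eq_zero_of_cone
    (hfull _ (singleton_nonempty (Classical.arbitrary ι)))
    (fun J _ => hfull _ (insert_nonempty _ J)) k

theorem integrableOn_reducedBetti [Nonempty ι] (hF : IsMonotoneFunctional F) (k : ℕ) :
    IntegrableOn (fun t => (reducedBetti K F hF k t : ℝ)) (Set.Ioi 0) := by
  have hbounded : IntegrableOn (fun t => (reducedBetti K F hF k t : ℝ)) (Set.Ioc 0 (F univ)) :=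
    Measure.integrableOn_of_bounded (M := Fintype.card (Finset ι)) (by simp)
      (measurable_from_nat.comp (measurable_reducedBetti hF k)).aestronglyMeasurable
      (.of_forall fun t => by
        rw [Real.norm_natCast]
        exact_mod_cast reducedBetti_le_card hF k t)
  refine hbounded.of_forall_sdiff_eq_zero measurableSet_Ioi fun t ht => ?_
  have hlt : F univ < t := not_le.1 fun h => ht.2 ⟨ht.1, h⟩
  rw [reducedBetti_eq_zero_of_univ_le hF k hlt.le, Nat.cast_zero]

theorem reducedIntegratedBetti_eq_zero_of_notMem_range (hF : IsMonotoneFunctional F) (ε : ℝ) {k : ℕ}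
    (hk : k ∉ range (Fintype.card ι)) : reducedIntegratedBetti K F hF k ε = 0 := by
  simp [reducedIntegratedBetti, reducedBetti,
    finrank_reducedHomology_eq_zero_of_card_le _ (not_lt.1 (mem_range.not.1 hk))]

theorem summable_reducedIntegratedBetti (hF : IsMonotoneFunctional F) (ε : ℝ) :
    Summable fun k => (-1 : ℝ) ^ k * reducedIntegratedBetti K F hF k ε :=
  summable_of_ne_finset_zero fun k hk => by
    rw [reducedIntegratedBetti_eq_zero_of_notMem_range hF ε hk, mul_zero]

theorem reducedIntegratedEulerChar_eq_integral [Nonempty ι] (hF : IsMonotoneFunctional F) {ε : ℝ}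
    (hε : 0 ≤ ε) :
    reducedIntegratedEulerChar K F hF ε =
      ∫ t in (0 : ℝ)..ε, ∑ k ∈ range (Fintype.card ι), (-1 : ℝ) ^ k * reducedBetti K F hF k t := by
  have hsum : reducedIntegratedEulerChar K F hF ε =
      ∑ k ∈ range (Fintype.card ι), (-1 : ℝ) ^ k * reducedIntegratedBetti K F hF k ε :=
    tsum_eq_sum fun k hk => by
      rw [reducedIntegratedBetti_eq_zero_of_notMem_range hF ε hk, mul_zero]
  have hint : ∀ k, IntervalIntegrable (fun t => (reducedBetti K F hF k t : ℝ)) volume 0 ε :=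
    fun k => (intervalIntegrable_iff_integrableOn_Ioc_of_le hε).2 <|
      (integrableOn_reducedBetti hF k).mono_set Set.Ioc_subset_Ioi_self
  simp only [hsum, reducedIntegratedBetti, ← intervalIntegral.integral_const_mul]
  exact (intervalIntegral.integral_finsetSum fun k _ => (hint k).const_mul _).symm

theorem sum_neg_one_pow_mul_reducedBetti (hF : IsMonotoneFunctional F) {t : ℝ}
    (ht : (sublevelComplex F hF t).faces.Nonempty) :
    ∑ k ∈ range (Fintype.card ι), (-1 : ℝ) ^ k * reducedBetti K F hF k t =
      ∑ J : Finset ι with J.Nonempty, (Set.Iio (F J)).indicator (fun _ => (-1) ^ #J) t := by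
  have : Nonempty ι := let ⟨_, hJ⟩ := ht; ⟨hJ.1.choose⟩
  have hfaces : ∑ k ∈ range (Fintype.card ι), (-1 : ℤ) ^ k * reducedBetti K F hF k t =
      ∑ J : Finset ι with J.Nonempty ∧ F J ≤ t, (-1) ^ (#J + 1) - 1 := by
    classical
    convert reduced_euler_poincare (K := K) ht <;> rfl
  have hsplit := sum_neg_one_pow_card_nonempty ι
  rw [← sum_filter_add_sum_filter_not _ (fun J => F J ≤ t), filter_filter] at hsplit
  have heuler : ∑ k ∈ range (Fintype.card ι), (-1 : ℤ) ^ k * reducedBetti K F hF k t =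
      ∑ J : Finset ι with J.Nonempty, if t < F J then (-1) ^ #J else 0 := by
    simp only [not_le] at hsplit
    rw [← sum_filter, hfaces]
    simp only [pow_succ, mul_neg_one, sum_neg_distrib]
    linear_combination -hsplit
  simp only [Set.indicator_apply, Set.mem_Iio]
  exact_mod_cast heuler

theorem intervalIntegrable_indicator_Iio_const (a c u v : ℝ) :
    IntervalIntegrable ((Set.Iio a).indicator fun _ => c) volume u v :=
  intervalIntegrable_iff.2 <| (integrableOn_const (by simp)).indicator measurableSet_Iio

theorem intervalIntegral_indicator_Iio_const {a b : ℝ} (ha : 0 ≤ a) (hab : a ≤ b) (c : ℝ) :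
    ∫ t in (0 : ℝ)..b, (Set.Iio a).indicator (fun _ => c) t = c * a := by
  have hinter : Set.Ioc 0 b ∩ Set.Iio a = Set.Ioo 0 a := by
    ext t
    simp only [Set.mem_inter_iff, Set.mem_Ioc, Set.mem_Iio, Set.mem_Ioo]
    grind
  rw [intervalIntegral.integral_of_le (ha.trans hab), setIntegral_indicator measurableSet_Iio,
    hinter, setIntegral_const, Real.volume_real_Ioo_of_le ha, sub_zero, smul_eq_mul, mul_comm]

theorem reducedIntegratedEulerChar_of_univ_le [Nonempty ι] (hF : IsMonotoneFunctional F)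
    (hvertex : ∀ v, F {v} = 0) {ε : ℝ} (hε : F univ ≤ ε) :
    reducedIntegratedEulerChar K F hF ε = ∑ J : Finset ι with J.Nonempty, (-1) ^ #J * F J := by
  have hnonneg : ∀ J : Finset ι, J.Nonempty → 0 ≤ F J := fun J ⟨v, hv⟩ =>
    (hvertex v).ge.trans (hF _ _ (singleton_nonempty v) (singleton_subset_iff.2 hv))
  have hε₀ : 0 ≤ ε := (hnonneg _ univ_nonempty).trans hε
  have heuler : ∀ t ∈ Set.uIcc 0 ε, ∑ k ∈ range (Fintype.card ι),
      (-1 : ℝ) ^ k * reducedBetti K F hF k t =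
        ∑ J : Finset ι with J.Nonempty, (Set.Iio (F J)).indicator (fun _ => (-1) ^ #J) t :=
    fun t ht => sum_neg_one_pow_mul_reducedBetti hF
      ⟨{Classical.arbitrary ι}, singleton_nonempty _,
        (hvertex _).le.trans (Set.uIcc_of_le hε₀ ▸ ht).1⟩
  rw [reducedIntegratedEulerChar_eq_integral hF hε₀, intervalIntegral.integral_congr heuler,
    intervalIntegral.integral_finsetSum fun _ _ => intervalIntegrable_indicator_Iio_const ..]
  refine sum_congr rfl fun J hJ => ?_
  have hJ : J.Nonempty := (mem_filter.1 hJ).2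
  exact intervalIntegral_indicator_Iio_const (hnonneg J hJ)
    ((hF J univ hJ (subset_univ J)).trans hε) _

theorem tendsto_reducedIntegratedEulerChar [Nonempty ι] (hF : IsMonotoneFunctional F)
    (hvertex : ∀ v, F {v} = 0) :
    Tendsto (reducedIntegratedEulerChar K F hF) atTop
      (𝓝 (∑ J : Finset ι with J.Nonempty, (-1) ^ #J * F J)) :=
  tendsto_const_nhds.congr' <| (eventually_ge_atTop (F univ)).mono fun _ hε =>
    (reducedIntegratedEulerChar_of_univ_le hF hvertex hε).symm

end Filtration

theorem sum_neg_one_pow_card_of_mem {ι : Type*} [Fintype ι] [DecidableEq ι] [Nontrivial ι] (v : ι) :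
    ∑ J : Finset ι with v ∈ J, (-1 : ℤ) ^ #J = 0 := by
  have hall := sum_powerset_neg_one_pow_card_of_nonempty (univ_nonempty (α := ι))
  have herase := sum_powerset_neg_one_pow_card_of_nonempty (x := univ.erase v) <|
    let ⟨w, hw⟩ := exists_ne v; ⟨w, mem_erase.2 ⟨hw, mem_univ w⟩⟩
  have hpowerset : (univ.erase v).powerset = ({J | v ∉ J} : Finset (Finset ι)) := by
    ext J
    simp [subset_erase]
  rw [powerset_univ, ← sum_filter_add_sum_filter_not _ (v ∈ ·), ← hpowerset, herase,
    add_zero] at hall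
  exact hall

theorem sum_neg_one_pow_card_mul_sum_eq_zero {R : Type*} [CommRing R] {ι : Type*} [Fintype ι]
    [Nontrivial ι] (f : ι → R) : ∑ J : Finset ι, (-1) ^ #J * ∑ v ∈ J, f v = 0 := by
  classical
  simp only [mul_sum]
  rw [sum_comm' (t' := univ) (s' := fun v => {J | v ∈ J}) (by simp)]
  refine sum_eq_zero fun v _ => ?_
  rw [← sum_mul, show ∑ J : Finset ι with v ∈ J, (-1 : R) ^ #J = 0 from
    mod_cast congr_arg (Int.cast : ℤ → R) (sum_neg_one_pow_card_of_mem v), zero_mul]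

theorem sum_neg_one_pow_card_mul_totalCorrelation {ι : Type*} [Fintype ι] [DecidableEq ι]
    [Nontrivial ι] {d : ι → Type*} [∀ i, Fintype (d i)] [∀ i, DecidableEq (d i)]
    {ρ : Matrix (∀ i, d i) (∀ i, d i) ℂ} (hρ : IsDensityOperator ρ) (q : ℝ) :
    ∑ J : Finset ι with J.Nonempty, (-1) ^ #J * totalCorrelation q ρ J =
      interactionInformation q ρ := by
  have hempty : ∀ J : Finset ι, (-1 : ℝ) ^ #J * totalCorrelation q ρ J ≠ 0 → J.Nonempty :=
    fun J hJ => nonempty_iff_ne_empty.2 <| by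
      rintro rfl
      exact hJ (by rw [totalCorrelation_empty hρ, mul_zero])
  rw [sum_filter_of_ne fun J _ => hempty J]
  simp only [totalCorrelation, mul_sub, sum_sub_distrib, sum_neg_one_pow_card_mul_sum_eq_zero,
    zero_sub, interactionInformation, ← sum_neg_distrib]
  refine sum_congr rfl fun J _ => ?_
  rw [zpow_sub_one₀ (by simp), zpow_natCast, inv_neg_one, mul_neg_one, neg_mul]

theorem mainTheorem1_general (K : Type*) [Field K] {ι : Type*} [Fintype ι] [LinearOrder ι]
    [Nontrivial ι] {d : ι → Type*} [∀ i, Fintype (d i)] [∀ i, DecidableEq (d i)]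
    {ρ : Matrix (∀ i, d i) (∀ i, d i) ℂ} (hρ : IsDensityOperator ρ) {q : ℝ} (hq : 1 < q) :
    ∃ hC : IsMonotoneFunctional (totalCorrelation q ρ),
      (∀ k, IntegrableOn (fun ε => (reducedBetti K (totalCorrelation q ρ) hC k ε : ℝ))
        (Set.Ioi 0)) ∧
      (∀ ε, Summable fun k => (-1) ^ k * reducedIntegratedBetti K (totalCorrelation q ρ) hC k ε) ∧
      Tendsto (reducedIntegratedEulerChar K (totalCorrelation q ρ) hC) atTop
        (𝓝 (interactionInformation q ρ)) := by
  refine ⟨fun _ _ _ hIJ => totalCorrelation_mono hq hρ hIJ, integrableOn_reducedBetti _,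
    summable_reducedIntegratedBetti _, ?_⟩
  rw [← sum_neg_one_pow_card_mul_totalCorrelation hρ]
  exact tendsto_reducedIntegratedEulerChar _ (totalCorrelation_singleton q ρ)

theorem mainTheorem1 (K : Type*) [Field K] (n : ℕ) (hn : 2 ≤ n) (d : Fin n → Type*)
    [∀ i, Fintype (d i)] [∀ i, DecidableEq (d i)] (ρ : Matrix (∀ i, d i) (∀ i, d i) ℂ)
    (hρ : IsDensityOperator ρ) (q : ℝ) (hq : 1 < q) :
    -- `C_q` is monotone, so that its sublevel sets form a filtration by simplicial complexes
    ∃ hC : IsMonotoneFunctional (totalCorrelation q ρ),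
      -- the integrals and the series defining the integrated Euler characteristic converge
      (∀ k : ℕ, MeasureTheory.IntegrableOn
        (fun ε : ℝ => (reducedBetti K (totalCorrelation q ρ) hC k ε : ℝ)) (Set.Ioi 0)) ∧
      (∀ ε : ℝ, Summable fun k : ℕ =>
        (-1 : ℝ) ^ k * reducedIntegratedBetti K (totalCorrelation q ρ) hC k ε) ∧
      -- its value at infinity is the interaction information
      Filter.Tendsto (reducedIntegratedEulerChar K (totalCorrelation q ρ) hC) Filter.atTop
        (nhds (interactionInformation q ρ)) := by
  have : Nontrivial (Fin n) := Fin.nontrivial_iff_two_le.2 hn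
  exact mainTheorem1_general K hρ hq
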